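/- Let $N\ge 1$ be an integer and let $p_c=\frac{(N-2)^2-4N+8\sqrt{N-1}}{(N-2)(N-10)}$ if $N>10$ and $p_c=\infty$ if $N\le 10$ (the Joseph–Lundgren exponent). Let $p\in\mathbb{R}$ with $p\ge p_c$ (so that $N>10$ and $p>1$), and set $$m=\frac{2}{p-1},\qquad L=\bigl(m(N-2-m)\bigr)^{1/(p-1)},\qquad \lambda_1=\frac{N-2-2m-\sqrt{(N-2-2m)^2-8(N-2-m)}}{2},\qquad \varphi_\infty(x)=L|x|^{-m}\quad(x\ne0).$$ Let $u\in C^2(\mathbb{R}^N)$ (real-valued, of any sign) satisfy $$\Delta u+|u|^{p-1}u=0\ \text{ in }\mathbb{R}^N,\qquad |u(x)|\le\varphi_\infty(x)\ \text{ for all } x\neq 0,$$ and assume that, as $|x|\to\infty$, $$u(x)=\frac{L}{|x|^{m}}+\frac{a}{|x|^{m+\lambda_1}}+o\!\left(\frac{1}{|x|^{m+\lambda_1}}\right)\ \text{ for some } a\le 0,\quad\text{if } p>p_c,$$ $$u(x)=\frac{L}{|x|^{m}}+\frac{b\,\ln|x|}{|x|^{m+\lambda_1}}+O\!\left(\frac{1}{|x|^{m+\lambda_1}}\right)\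 \text{ for some } b<0,\quad\text{if } p=p_c.$$ Then $u$ is radially symmetric about the origin. Moreover, there is exactly one positive function $\Phi\in C^2(\mathbb{R}^N)$, radially symmetric about the origin, with $\Delta\Phi+\Phi^p=0$ in $\mathbb{R}^N$ and $\Phi(0)=1$, and there is $\gamma\in(0,\infty)$ such that $u\equiv\varphi_\gamma$, where $\varphi_\gamma(x)=\gamma\,\Phi\bigl(\gamma^{(p-1)/2}x\bigr)$. -/

import Mathlib

open Asymptotics
open scoped Laplacian

/-- `ℝ^N` with the Euclidean norm. -/
abbrev Space (N : ℕ) : Type := EuclideanSpace ℝ (Fin N)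

/-- The Joseph-Lundgren exponent `p_c`, with value `∞` in dimensions `N ≤ 10`. -/
noncomputable def jlExponent (N : ℕ) : EReal :=
  if 10 < N then
    (((((N : ℝ) - 2) ^ 2 - 4 * N + 8 * √((N : ℝ) - 1)) /
      (((N : ℝ) - 2) * ((N : ℝ) - 10)) : ℝ) : EReal)
  else ⊤

/-- The decay exponent `m = 2 / (p - 1)`. -/
noncomputable def decayExp (p : ℝ) : ℝ := 2 / (p - 1)

/-- The constant `L` of the singular steady state. -/
noncomputable def singConst (N : ℕ) (p : ℝ) : ℝ :=
  (2 / (p - 1) * ((N : ℝ) - 2 - 2 / (p - 1))) ^ (1 / (p - 1))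

/-- The singular steady state `φ_∞(x) = L |x|^{-m}`; meaningful for `x ≠ 0`. -/
noncomputable def singularState (N : ℕ) (p : ℝ) (x : Space N) : ℝ :=
  singConst N p * ‖x‖ ^ (-decayExp p)

/-- The smaller characteristic exponent `λ₁`. -/
noncomputable def lambdaOne (N : ℕ) (p : ℝ) : ℝ :=
  ((N : ℝ) - 2 - 2 * decayExp p -
    √(((N : ℝ) - 2 - 2 * decayExp p) ^ 2 - 8 * ((N : ℝ) - 2 - decayExp p))) / 2

/-- Radial symmetry about the origin. -/
def IsRadial {N : ℕ} (u : Space N → ℝ) : Prop :=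
  ∀ x y : Space N, ‖x‖ = ‖y‖ → u x = u y

/-- `Φ` is a positive, radially symmetric, classical solution of `ΔΦ + Φ^p = 0` on `ℝ^N`
with `Φ(0) = 1`. -/
structure IsRadialSteadyState {N : ℕ} (p : ℝ) (Φ : Space N → ℝ) : Prop where
  contDiff : ContDiff ℝ 2 Φ
  pos : ∀ x, 0 < Φ x
  equation : ∀ x, Δ Φ x + Φ x ^ p = 0
  radial : IsRadial Φ
  value_zero : Φ 0 = 1

/-- The rescaling `φ_γ(x) = γ Φ(γ^{(p-1)/2} x)`. -/
noncomputable def rescale {N : ℕ} (p : ℝ) (Φ : Space N → ℝ) (γ : ℝ) (x : Space N) : ℝ :=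
  γ * Φ (γ ^ ((p - 1) / 2) • x)

/-!
Write `m = 2 / (p - 1)`, `k = m + λ₁`, `φ_∞ = L |x|^{-m}`. For `p ≥ p_c` the discriminant in `λ₁`
is nonnegative, so `k` is a root of `k (N - 2 - k) = p L^{p-1}`; at `p = p_c` it is the double
root `(N - 2) / 2`. Since `p φ_∞^{p-1} = k (N - 2 - k) |x|^{-2}`, the power `|x|^{-k}` solves the
linearization of the equation at `φ_∞`, and at `p = p_c` so does `|x|^{-k} log |x|`.

If `u₁, u₂` are solutions with `|uᵢ| ≤ φ_∞`, their difference solves a linear equation whose potential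
is strictly smaller, so the quotient of `u₁ - u₂` by a positive solution `W` of the linearized equation
has no positive interior maximum (`not_isLocalMax_sub_barrier`, `sub_le_barrier`). At the origin
`|x|^{-k}` blows up while `u₁ - u₂` stays bounded. Hence `u₁ ≤ u₂` as soon as the difference is
`o(|x|^{-k})` from above at infinity; for `p = p_c` a bound `O(|x|^{-k})` is enough, by comparing
with `|x|^{-k} (ε + δ log (|x| / r))` and letting `δ` and then `ε` tend to zero
(`sub_nonpos_of_decay`).

Applied to `u` and its composition with a reflection, whose asymptotic expansions agree, this gives
the radial symmetry of `u`. Applied to `0` and `u`, which is positive at infinity, it gives `u ≥ 0`.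
A radial superharmonic function is nonincreasing in `|x|`, so `u > 0`. The normalized steady state
`Φ` is then `u` itself, rescaled with `γ = u 0`, and it is the only one because the singular initial
value problem for radial solutions has at most one solution, by an energy estimate
(`IsProfile.eq_of_eq_zero`).
-/

open Filter Topology Set

/-! ### The Laplacian through lines, and of radial functions -/

lemma deriv_deriv_line {E : Type*} [NormedAddCommGroup E] [NormedSpace ℝ E] {h : E → ℝ} {x : E}
    (hh : ContDiffAt ℝ 2 h x) (v : E) :
    deriv (deriv fun t : ℝ => h (x + t • v)) 0 = iteratedFDeriv ℝ 2 h x ![v, v] := by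
  have hline : ∀ t : ℝ, HasDerivAt (fun t : ℝ => x + t • v) v t := fun t => by
    simpa using ((hasDerivAt_id t).smul_const v).const_add x
  have hcont : Tendsto (fun t : ℝ => x + t • v) (𝓝 0) (𝓝 x) := by
    simpa using (hline 0).continuousAt.tendsto
  have h1 : ∀ᶠ y in 𝓝 x, ContDiffAt ℝ 2 h y := hh.eventually (by simp)
  have h2 : (deriv fun t : ℝ => h (x + t • v)) =ᶠ[𝓝 0] fun t => fderiv ℝ h (x + t • v) v := by
    filter_upwards [hcont.eventually h1] with t ht
    exact ((ht.differentiableAt (by simp)).hasFDerivAt.comp_hasDerivAt t (hline t)).deriv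
  rw [h2.deriv_eq, iteratedFDeriv_two_apply]
  have h3 : DifferentiableAt ℝ (fderiv ℝ h) (x + (0 : ℝ) • v) := by
    simpa using (hh.fderiv_right (m := 1) (by norm_num)).differentiableAt (by simp)
  have h4 : HasDerivAt (fun t : ℝ => fderiv ℝ h (x + t • v))
      (fderiv ℝ (fderiv ℝ h) (x + (0 : ℝ) • v) v) 0 :=
    h3.hasFDerivAt.comp_hasDerivAt (0 : ℝ) (hline 0)
  have h5 : HasDerivAt (fun t : ℝ => fderiv ℝ h (x + t • v) v)
      (fderiv ℝ (fderiv ℝ h) (x + (0 : ℝ) • v) v v) 0 := by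
    simpa using h4.clm_apply (hasDerivAt_const 0 v)
  rw [h5.deriv, zero_smul, add_zero]
  rfl

lemma laplacian_eq_sum_deriv {N : ℕ} {h : Space N → ℝ} {x : Space N} (hh : ContDiffAt ℝ 2 h x) :
    Δ h x = ∑ i, deriv (deriv fun t : ℝ => h (x + t • EuclideanSpace.basisFun (Fin N) ℝ i)) 0 := by
  rw [InnerProductSpace.laplacian_eq_iteratedFDeriv_orthonormalBasis h
    (EuclideanSpace.basisFun (Fin N) ℝ)]
  exact Finset.sum_congr rfl fun i _ => (deriv_deriv_line hh _).symm

lemma IsLocalMax.deriv_deriv_nonpos {f : ℝ → ℝ} {a : ℝ} (hf : IsLocalMax f a)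
    (hc : ContinuousAt f a) : deriv (deriv f) a ≤ 0 := by
  by_contra! hpos
  -- A positive second derivative would make `a` a local minimum too, hence `f` locally constant.
  have hmin := isLocalMin_of_deriv_deriv_pos hpos hf.deriv_eq_zero hc
  have hconst : f =ᶠ[𝓝 a] fun _ => f a := by
    filter_upwards [hf, hmin] with y h1 h2 using le_antisymm h1 h2
  have h1 : deriv f =ᶠ[𝓝 a] fun _ => (0 : ℝ) := by
    simpa using hconst.deriv
  rw [h1.deriv_eq] at hpos
  simp at hpos

lemma IsLocalMax.laplacian_nonpos {N : ℕ} {h : Space N → ℝ} {x : Space N} (hmax : IsLocalMax h x)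
    (hh : ContDiffAt ℝ 2 h x) : Δ h x ≤ 0 := by
  rw [laplacian_eq_sum_deriv hh]
  refine Finset.sum_nonpos fun i _ => ?_
  set v := EuclideanSpace.basisFun (Fin N) ℝ i
  have hcont : ContinuousAt (fun t : ℝ => x + t • v) 0 := by fun_prop
  have hcont' : Tendsto (fun t : ℝ => x + t • v) (𝓝 0) (𝓝 x) := by simpa using hcont.tendsto
  refine IsLocalMax.deriv_deriv_nonpos ?_ ?_
  · filter_upwards [hcont'.eventually hmax] with t ht
    simpa using ht
  · have : ContinuousAt h (x + (0 : ℝ) • v) := by simpa using hh.continuousAt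
    exact ContinuousAt.comp (f := fun t : ℝ => x + t • v) this hcont

lemma norm_add_smul_unit {E : Type*} [NormedAddCommGroup E] [InnerProductSpace ℝ E] (x : E) {v : E}
    (hv : ‖v‖ = 1) (t : ℝ) : ‖x + t • v‖ = √(‖x‖ ^ 2 + 2 * t * inner ℝ x v + t ^ 2) := by
  rw [← Real.sqrt_sq (norm_nonneg (x + t • v)), norm_add_sq_real, inner_smul_right, norm_smul, hv,
    mul_one, Real.norm_eq_abs, sq_abs]
  ring_nf

/-- The Laplacian of `y ↦ f ‖y‖` away from the origin is `f'' + (N - 1) / r * f'`. -/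
lemma laplacian_radial {N : ℕ} {f f₁ : ℝ → ℝ} {f₂ : ℝ} {x : Space N} (hx : x ≠ 0)
    (hf : ContDiffAt ℝ 2 f ‖x‖) (h₁ : ∀ᶠ s in 𝓝 ‖x‖, HasDerivAt f (f₁ s) s)
    (h₂ : HasDerivAt f₁ f₂ ‖x‖) :
    Δ (fun y : Space N => f ‖y‖) x = f₂ + ((N : ℝ) - 1) / ‖x‖ * f₁ ‖x‖ := by
  have hx0 : 0 < ‖x‖ := norm_pos_iff.2 hx
  have hC : ContDiffAt ℝ 2 (fun y : Space N => f ‖y‖) x :=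
    ContDiffAt.comp x (f := fun y : Space N => ‖y‖) hf (contDiffAt_norm ℝ hx)
  rw [laplacian_eq_sum_deriv hC]
  have key : ∀ i, deriv (deriv fun t : ℝ => f ‖x + t • EuclideanSpace.basisFun (Fin N) ℝ i‖) 0 =
      (f₂ / ‖x‖ ^ 2 - f₁ ‖x‖ / ‖x‖ ^ 3) * x i ^ 2 + f₁ ‖x‖ / ‖x‖ := by
    intro i
    set v := EuclideanSpace.basisFun (Fin N) ℝ i with hv
    have hv1 : ‖v‖ = 1 := (EuclideanSpace.basisFun (Fin N) ℝ).norm_eq_one i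
    have hxv : inner ℝ x v = x i := by simp [hv, EuclideanSpace.inner_single_right]
    have hcont : ContinuousAt (fun t : ℝ => x + t • v) 0 := by fun_prop
    have hcont' : Tendsto (fun t : ℝ => x + t • v) (𝓝 0) (𝓝 x) := by simpa using hcont.tendsto
    have hρ : ∀ᶠ t : ℝ in 𝓝 0,
        HasDerivAt (fun t : ℝ => ‖x + t • v‖) ((x i + t) / ‖x + t • v‖) t := by
      filter_upwards [hcont'.eventually (isOpen_ne.mem_nhds hx)] with t ht
      have ht0 : ‖x + t • v‖ ≠ 0 := norm_ne_zero_iff.2 ht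
      simp only [norm_add_smul_unit x hv1, hxv] at ht0 ⊢
      have hq : HasDerivAt (fun t : ℝ => ‖x‖ ^ 2 + 2 * t * x i + t ^ 2) (2 * x i + 2 * t) t := by
        simpa using ((((hasDerivAt_id t).const_mul 2).mul_const (x i)).const_add (‖x‖ ^ 2)).fun_add
          (hasDerivAt_pow 2 t)
      have := hq.sqrt (fun h => ht0 (by rw [h, Real.sqrt_zero]))
      convert this using 1
      field_simp
    have hn0 : Tendsto (fun t : ℝ => ‖x + t • v‖) (𝓝 0) (𝓝 ‖x‖) := hcont'.norm
    have hd : (deriv fun t : ℝ => f ‖x + t • v‖) =ᶠ[𝓝 0]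
        fun t => f₁ ‖x + t • v‖ * ((x i + t) / ‖x + t • v‖) := by
      filter_upwards [hρ, hn0.eventually h₁] with t ht ht1
      exact (ht1.comp t ht).deriv
    rw [hd.deriv_eq]
    have hρ0 : HasDerivAt (fun t : ℝ => ‖x + t • v‖) (x i / ‖x‖) 0 := by
      simpa using hρ.self_of_nhds
    have h₂' : HasDerivAt f₁ f₂ ‖x + (0 : ℝ) • v‖ := by simpa using h₂
    have h5 := (h₂'.comp (0 : ℝ) hρ0).mul (((hasDerivAt_id (0 : ℝ)).const_add (x i)).div hρ0
      (by simpa using hx))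
    have h6 := h5.deriv
    simp only [zero_smul, add_zero, id] at h6
    refine Eq.trans ?_ (h6.trans ?_)
    · rfl
    · simp only [Function.comp_apply, zero_smul, add_zero, Pi.div_apply]
      field_simp
      ring
  rw [Finset.sum_congr rfl fun i _ => key i, Finset.sum_add_distrib, ← Finset.mul_sum,
    ← EuclideanSpace.real_norm_sq_eq]
  simp only [Finset.sum_const, Finset.card_univ, Fintype.card_fin, nsmul_eq_mul]
  field_simp
  ring

/-! ### The exponents -/

/-- For `p ≥ p_c` the discriminant in `λ₁` is nonnegative, and it vanishes when `p = p_c`. -/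
lemma exponent_bounds {N : ℕ} {p : ℝ} (hp : jlExponent N ≤ (p : EReal)) :
    10 < N ∧ 1 < p ∧ decayExp p < ((N : ℝ) - 4) / 2 ∧
      0 ≤ ((N : ℝ) - 2 - 2 * decayExp p) ^ 2 - 8 * ((N : ℝ) - 2 - decayExp p) ∧
      ((p : EReal) = jlExponent N →
        ((N : ℝ) - 2 - 2 * decayExp p) ^ 2 - 8 * ((N : ℝ) - 2 - decayExp p) = 0) := by
  have hN : 10 < N := by
    by_contra hN
    simp [jlExponent, hN] at hp
  have hNr : (11 : ℝ) ≤ N := by exact_mod_cast hN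
  set s := √((N : ℝ) - 1) with hs
  have hs2 : s ^ 2 = N - 1 := Real.sq_sqrt (by linarith)
  have hs0 : 0 ≤ s := Real.sqrt_nonneg _
  have hd : 0 < (N : ℝ) - 4 - 2 * s := by nlinarith
  have hq : (((N : ℝ) - 2) ^ 2 - 4 * N + 8 * s) / (((N : ℝ) - 2) * ((N : ℝ) - 10)) =
      1 + 4 / ((N : ℝ) - 4 - 2 * s) := by
    have h1 : ((N : ℝ) - 2) * ((N : ℝ) - 10) = ((N : ℝ) - 4 - 2 * s) * (N - 4 + 2 * s) := by
      linear_combination 4 * hs2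
    have h2 : 0 < (N : ℝ) - 4 + 2 * s := by linarith
    rw [h1]
    field_simp
    linear_combination 4 * hs2
  have hj : jlExponent N = ((1 + 4 / ((N : ℝ) - 4 - 2 * s) : ℝ) : EReal) := by
    rw [jlExponent, if_pos hN, ← hs, hq]
  rw [hj] at hp ⊢
  have hp' : 1 + 4 / ((N : ℝ) - 4 - 2 * s) ≤ p := by exact_mod_cast hp
  have hp1 : 1 < p := by
    have : 0 < 4 / ((N : ℝ) - 4 - 2 * s) := by positivity
    linarith
  have hm : decayExp p ≤ ((N : ℝ) - 4 - 2 * s) / 2 := by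
    have h3 : 4 / ((N : ℝ) - 4 - 2 * s) ≤ p - 1 := by linarith
    rw [div_le_iff₀ hd] at h3
    rw [decayExp, div_le_iff₀ (by linarith)]
    linarith
  have hs1 : 0 < s := Real.sqrt_pos.2 (by linarith)
  have hfac : ((N : ℝ) - 2 - 2 * decayExp p) ^ 2 - 8 * ((N : ℝ) - 2 - decayExp p) =
      ((N : ℝ) - 4 - 2 * decayExp p - 2 * s) * ((N : ℝ) - 4 - 2 * decayExp p + 2 * s) := by
    linear_combination 4 * hs2
  refine ⟨hN, hp1, by linarith, ?_, fun h => ?_⟩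
  · rw [hfac]
    exact mul_nonneg (by linarith) (by linarith)
  · have h4 : p = 1 + 4 / ((N : ℝ) - 4 - 2 * s) := by exact_mod_cast h
    have h5 : decayExp p = ((N : ℝ) - 4 - 2 * s) / 2 := by
      rw [decayExp, h4]
      field_simp
      ring
    rw [hfac, h5]
    ring

/-- The exponents `p ≥ p_c` in the form used below: with `k = m + λ₁`, the power `|x|^{-k}` solves
the linearization of the equation at the singular state. -/
lemma exponent_relations {N : ℕ} {p : ℝ} (hp : jlExponent N ≤ (p : EReal)) :
    10 < N ∧ 1 < p ∧ 0 < decayExp p ∧ decayExp p < (N : ℝ) - 2 ∧ 0 < lambdaOne N p ∧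
      (decayExp p + lambdaOne N p) * ((N : ℝ) - 2 - (decayExp p + lambdaOne N p)) =
        p * (decayExp p * ((N : ℝ) - 2 - decayExp p)) ∧
      ((p : EReal) = jlExponent N → (N : ℝ) - 2 - 2 * (decayExp p + lambdaOne N p) = 0) := by
  obtain ⟨hN, hp1, hm, hD, hD0⟩ := exponent_bounds hp
  have hNr : (11 : ℝ) ≤ N := by exact_mod_cast hN
  have hm0 : 0 < decayExp p := div_pos two_pos (by linarith)
  have hpm : p * decayExp p = decayExp p + 2 := by
    have : p - 1 ≠ 0 := by linarith
    rw [decayExp]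
    field_simp
    ring
  refine ⟨hN, hp1, hm0, by linarith, ?_, ?_, ?_⟩
  · have : √(((N : ℝ) - 2 - 2 * decayExp p) ^ 2 - 8 * ((N : ℝ) - 2 - decayExp p)) <
        (N : ℝ) - 2 - 2 * decayExp p := by
      rw [Real.sqrt_lt' (by linarith)]
      linarith
    rw [lambdaOne]
    linarith
  · have h := Real.sq_sqrt hD
    rw [lambdaOne]
    set S := √(((N : ℝ) - 2 - 2 * decayExp p) ^ 2 - 8 * ((N : ℝ) - 2 - decayExp p))
    linear_combination (-1 / 4) * h - ((N : ℝ) - 2 - decayExp p) * hpm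
  · intro h
    rw [lambdaOne, hD0 h, Real.sqrt_zero]
    ring

lemma singularState_rpow {N : ℕ} {p : ℝ} (hp : 1 < p) (hm : decayExp p < (N : ℝ) - 2)
    {x : Space N} (hx : x ≠ 0) :
    singularState N p x ^ (p - 1) = decayExp p * ((N : ℝ) - 2 - decayExp p) / ‖x‖ ^ 2 := by
  have hx0 : 0 < ‖x‖ := norm_pos_iff.2 hx
  have hp1 : p - 1 ≠ 0 := by linarith
  have hm0 : 0 < decayExp p := div_pos two_pos (by linarith)
  have hL : 0 ≤ decayExp p * ((N : ℝ) - 2 - decayExp p) := mul_nonneg hm0.le (by linarith)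
  have hsc : singConst N p = (decayExp p * ((N : ℝ) - 2 - decayExp p)) ^ (1 / (p - 1)) := rfl
  rw [singularState, hsc, Real.mul_rpow (by positivity) (by positivity), ← Real.rpow_mul hL,
    ← Real.rpow_mul hx0.le, one_div_mul_cancel hp1, Real.rpow_one]
  have : -decayExp p * (p - 1) = -(2 : ℕ) := by
    rw [decayExp]
    field_simp
    norm_num
  rw [this, Real.rpow_neg hx0.le, Real.rpow_natCast, div_eq_mul_inv]

lemma singConst_pos {N : ℕ} {p : ℝ} (hp : 1 < p) (hm : decayExp p < (N : ℝ) - 2) :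
    0 < singConst N p := by
  have hm0 : 0 < decayExp p := div_pos two_pos (by linarith)
  have hm1 : 0 < (N : ℝ) - 2 - decayExp p := by linarith
  exact Real.rpow_pos_of_pos (mul_pos hm0 hm1) _

/-! ### The nonlinearity -/

lemma abs_rpow_mul_self_of_nonneg {p s : ℝ} (hp : 1 < p) (hs : 0 ≤ s) :
    |s| ^ (p - 1) * s = s ^ p := by
  rcases hs.eq_or_lt with rfl | hs
  · simp [Real.zero_rpow (by linarith : p ≠ 0)]
  · rw [abs_of_pos hs, Real.rpow_sub_one hs.ne']
    field_simp

/-- On `[-M, M]` the nonlinearity has all its difference quotients strictly below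
its slope at the endpoints. -/
lemma abs_rpow_mul_self_sub_lt {p M a b : ℝ} (hp : 1 < p) (ha : -M ≤ a) (hab : a < b)
    (hb : b ≤ M) :
    |b| ^ (p - 1) * b - |a| ^ (p - 1) * a < p * M ^ (p - 1) * (b - a) := by
  have hpos : StrictAntiOn (fun s : ℝ => |s| ^ (p - 1) * s - p * M ^ (p - 1) * s) (Icc 0 M) := by
    have h : StrictAntiOn (fun s : ℝ => s ^ p - p * M ^ (p - 1) * s) (Icc 0 M) := by
      refine strictAntiOn_of_deriv_neg (convex_Icc 0 M) ?_ fun s hs => ?_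
      · exact ((Real.continuous_rpow_const (by linarith)).sub (by fun_prop)).continuousOn
      · rw [interior_Icc] at hs
        have h1 : HasDerivAt (fun s : ℝ => s ^ p - p * M ^ (p - 1) * s)
            (p * s ^ (p - 1) - p * M ^ (p - 1) * 1) s :=
          (Real.hasDerivAt_rpow_const (Or.inr hp.le)).sub ((hasDerivAt_id s).const_mul _)
        rw [h1.deriv, mul_one, sub_neg]
        have := Real.rpow_lt_rpow hs.1.le hs.2 (by linarith : 0 < p - 1)
        nlinarith
    refine h.congr fun s hs => ?_
    simp only [abs_rpow_mul_self_of_nonneg hp hs.1]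
  have hneg : StrictAntiOn (fun s : ℝ => |s| ^ (p - 1) * s - p * M ^ (p - 1) * s) (Icc (-M) 0) := by
    intro s hs t ht hst
    have := hpos (a := -t) ⟨by linarith [ht.2], by linarith [ht.1]⟩ (b := -s)
      ⟨by linarith [hs.2], by linarith [hs.1]⟩ (by linarith)
    simp only [abs_neg] at this ⊢
    linarith
  have hM : 0 ≤ M := by linarith
  have h := hneg.union hpos (isGreatest_Icc (by linarith)) (isLeast_Icc hM)
  rw [Icc_union_Icc_eq_Icc (by linarith) hM] at h
  have := h ⟨ha, by linarith⟩ ⟨by linarith, hb⟩ hab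
  simp only at this
  linarith

/-! ### Barriers -/

/-- The radial profile `s^{-k} (A + δ log s)`. -/
noncomputable def barrier (k A δ s : ℝ) : ℝ := s ^ (-k) * (A + δ * Real.log s)

lemma hasDerivAt_barrier (k A δ : ℝ) {s : ℝ} (hs : 0 < s) :
    HasDerivAt (barrier k A δ) (barrier (k + 1) (δ - k * A) (-(k * δ)) s) s := by
  have h1 : HasDerivAt (fun s : ℝ => s ^ (-k)) (-k * s ^ (-k - 1)) s :=
    Real.hasDerivAt_rpow_const (Or.inl hs.ne')
  have h2 : HasDerivAt (fun s : ℝ => A + δ * Real.log s) (δ * s⁻¹) s :=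
    ((Real.hasDerivAt_log hs.ne').const_mul δ).const_add A
  refine (h1.mul h2).congr_deriv ?_
  rw [barrier, neg_add', Real.rpow_sub_one hs.ne']
  field_simp
  ring

lemma contDiffAt_barrier (k A δ : ℝ) {s : ℝ} (hs : 0 < s) : ContDiffAt ℝ 2 (barrier k A δ) s :=
  (Real.contDiffAt_rpow_const (Or.inl hs.ne')).mul
    (contDiffAt_const.add (contDiffAt_const.mul (Real.contDiffAt_log.2 hs.ne')))

/-- The power `|x|^{-k}` always solves `ΔW + k (N - 2 - k) |x|^{-2} W = 0`; the logarithmic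
companion does so when `k` is the double root `(N - 2) / 2` of the characteristic polynomial. -/
lemma laplacian_barrier {N : ℕ} {k A δ : ℝ} (hδ : δ * ((N : ℝ) - 2 - 2 * k) = 0) {x : Space N}
    (hx : x ≠ 0) :
    Δ (fun y : Space N => barrier k A δ ‖y‖) x =
      -(k * ((N : ℝ) - 2 - k) / ‖x‖ ^ 2) * barrier k A δ ‖x‖ := by
  have hx0 : 0 < ‖x‖ := norm_pos_iff.2 hx
  rw [laplacian_radial hx (contDiffAt_barrier k A δ hx0)
    ((lt_mem_nhds hx0).mono fun s hs => hasDerivAt_barrier k A δ hs)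
    (hasDerivAt_barrier _ _ _ hx0)]
  simp only [barrier, neg_add', Real.rpow_sub_one hx0.ne']
  field_simp
  linear_combination hδ

/-! ### Comparison with barriers -/

/-- A classical solution of `Δu + |u|^{p-1} u = 0` on `ℝ^N`, of any sign, bounded in absolute value
by the singular steady state. -/
structure IsSubsingularSolution {N : ℕ} (p : ℝ) (u : Space N → ℝ) : Prop where
  contDiff : ContDiff ℝ 2 u
  equation : ∀ x, Δ u x + |u x| ^ (p - 1) * u x = 0
  bound : ∀ x, x ≠ 0 → |u x| ≤ singularState N p x

/-- A positive interior maximum of the quotient of `u₁ - u₂` by a barrier is impossible: there the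
difference has a linearized potential strictly below `k (N - 2 - k) |x|^{-2}`, because
`|u₁|, |u₂| ≤ φ_∞`. -/
lemma not_isLocalMax_sub_barrier {N : ℕ} {p k A δ t : ℝ} (hp : 1 < p) (hm : decayExp p < (N : ℝ) - 2)
    (hk : k * ((N : ℝ) - 2 - k) = p * (decayExp p * ((N : ℝ) - 2 - decayExp p)))
    (hδ : δ * ((N : ℝ) - 2 - 2 * k) = 0) {u₁ u₂ : Space N → ℝ} (h₁ : IsSubsingularSolution p u₁)
    (h₂ : IsSubsingularSolution p u₂) {x : Space N} (hx : x ≠ 0)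
    (hpos : u₂ x < u₁ x) (ht : u₁ x - u₂ x = t * barrier k A δ ‖x‖) :
    ¬ IsLocalMax (fun y => u₁ y - u₂ y - t * barrier k A δ ‖y‖) x := by
  intro hmax
  have hx0 : 0 < ‖x‖ := norm_pos_iff.2 hx
  have c₁ : ContDiffAt ℝ 2 u₁ x := h₁.contDiff.contDiffAt
  have c₂ : ContDiffAt ℝ 2 u₂ x := h₂.contDiff.contDiffAt
  have c₃ : ContDiffAt ℝ 2 (fun y : Space N => barrier k A δ ‖y‖) x :=
    ContDiffAt.comp x (f := fun y : Space N => ‖y‖) (contDiffAt_barrier k A δ hx0)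
      (contDiffAt_norm ℝ hx)
  have c₄ := c₃.const_smul t
  have hle := hmax.laplacian_nonpos ((c₁.sub c₂).sub c₄)
  have hΔ : Δ (fun y => u₁ y - u₂ y - t * barrier k A δ ‖y‖) x =
      Δ u₁ x - Δ u₂ x - t * Δ (fun y : Space N => barrier k A δ ‖y‖) x := by
    rw [← c₁.laplacian_sub c₂, ← smul_eq_mul, ← InnerProductSpace.laplacian_smul t c₃]
    exact (c₁.sub c₂).laplacian_sub c₄
  have hlt := abs_rpow_mul_self_sub_lt hp (neg_le_of_abs_le (h₂.bound x hx)) hpos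
    (le_of_abs_le (h₁.bound x hx))
  rw [singularState_rpow hp hm hx] at hlt
  rw [hΔ, laplacian_barrier hδ hx, hk] at hle
  have e₁ := h₁.equation x
  have e₂ := h₂.equation x
  have e₃ : t * (-(p * (decayExp p * ((N : ℝ) - 2 - decayExp p)) / ‖x‖ ^ 2) * barrier k A δ ‖x‖) =
      -(p * (decayExp p * ((N : ℝ) - 2 - decayExp p) / ‖x‖ ^ 2) * (u₁ x - u₂ x)) := by
    rw [ht]
    ring
  linarith

/-- Comparison principle in the exterior of a ball. -/
lemma sub_le_barrier {N : ℕ} {p k A δ r₀ : ℝ} (hp : 1 < p) (hm : decayExp p < (N : ℝ) - 2)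
    (hk : k * ((N : ℝ) - 2 - k) = p * (decayExp p * ((N : ℝ) - 2 - decayExp p)))
    (hδ : δ * ((N : ℝ) - 2 - 2 * k) = 0) {u₁ u₂ : Space N → ℝ} (h₁ : IsSubsingularSolution p u₁)
    (h₂ : IsSubsingularSolution p u₂) (hr₀ : 0 < r₀)
    (hpos : ∀ s, r₀ ≤ s → 0 < barrier k A δ s)
    (hin : ∀ x : Space N, ‖x‖ = r₀ → u₁ x - u₂ x ≤ barrier k A δ ‖x‖)
    (hout : ∀ᶠ x in Bornology.cobounded (Space N), u₁ x - u₂ x ≤ barrier k A δ ‖x‖)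
    {x : Space N} (hx : r₀ ≤ ‖x‖) : u₁ x - u₂ x ≤ barrier k A δ ‖x‖ := by
  obtain ⟨R, -, hR⟩ := Filter.hasBasis_cobounded_norm.mem_iff.1 hout
  by_contra! hlt
  set K : Set (Space N) := Metric.closedBall 0 R ∩ {y | r₀ ≤ ‖y‖} with hK
  have hKc : IsCompact K := (isCompact_closedBall 0 R).inter_right
    (isClosed_le continuous_const continuous_norm)
  have hxK : x ∈ K := by
    refine ⟨?_, hx⟩
    rw [mem_closedBall_zero_iff]
    by_contra! h
    exact absurd (hR (show R ≤ ‖x‖ from h.le)) (not_le.2 hlt)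
  have hψ : ContinuousOn (fun y : Space N => (u₁ y - u₂ y) / barrier k A δ ‖y‖) K := by
    intro y hy
    have hy0 : 0 < ‖y‖ := hr₀.trans_le hy.2
    refine ContinuousAt.continuousWithinAt (ContinuousAt.div ?_ ?_ (hpos _ hy.2).ne')
    · exact (h₁.contDiff.continuous.sub h₂.contDiff.continuous).continuousAt
    · exact ContinuousAt.comp (f := fun y : Space N => ‖y‖) (contDiffAt_barrier k A δ hy0).continuousAt
        continuous_norm.continuousAt
  obtain ⟨z, hzK, hz⟩ := hKc.exists_isMaxOn ⟨x, hxK⟩ hψ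
  have hBz := hpos _ hzK.2
  have hz1 : 1 < (u₁ z - u₂ z) / barrier k A δ ‖z‖ :=
    ((one_lt_div (hpos _ hx)).2 hlt).trans_le (hz hxK)
  have hz2 : barrier k A δ ‖z‖ < u₁ z - u₂ z := (one_lt_div hBz).1 hz1
  have hzr : r₀ < ‖z‖ := lt_of_le_of_ne hzK.2 fun h => absurd (hin z h.symm) (not_le.2 hz2)
  have hzR : ‖z‖ < R := by
    by_contra! h
    exact absurd (hR (show R ≤ ‖z‖ from h)) (not_le.2 hz2)
  have hz0 : z ≠ 0 := norm_pos_iff.1 (hr₀.trans hzr)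
  have hzt := (div_mul_cancel₀ (u₁ z - u₂ z) hBz.ne').symm
  refine not_isLocalMax_sub_barrier hp hm hk hδ h₁ h₂ hz0 (by linarith) hzt ?_
  have hnhds : ∀ᶠ y : Space N in 𝓝 z, r₀ < ‖y‖ ∧ ‖y‖ < R :=
    (continuous_norm.continuousAt.eventually (lt_mem_nhds hzr)).and
      (continuous_norm.continuousAt.eventually (gt_mem_nhds hzR))
  filter_upwards [hnhds] with y hy
  have h := hz (show y ∈ K from ⟨mem_closedBall_zero_iff.2 hy.2.le, hy.1.le⟩)
  have h' := (div_le_iff₀ (hpos _ hy.1.le)).1 h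
  linarith

/-- A continuous function is below any multiple of `|x|^{-k}` near the origin. -/
lemma exists_radius_le_rpow {N : ℕ} {k ε ρ : ℝ} (hk : 0 < k) (hε : 0 < ε) (hρ : 0 < ρ)
    {v : Space N → ℝ} (hv : Continuous v) :
    ∃ r, 0 < r ∧ r < ρ ∧ ∀ x : Space N, ‖x‖ = r → v x ≤ ε * r ^ (-k) := by
  have h0 : ∀ᶠ x in 𝓝 (0 : Space N), v x < v 0 + 1 :=
    hv.continuousAt.eventually (gt_mem_nhds (lt_add_one _))
  obtain ⟨d, hd, hd'⟩ := Metric.eventually_nhds_iff.1 h0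
  have h1 : ∀ᶠ r : ℝ in 𝓝[>] 0, (v 0 + 1) / ε ≤ r ^ (-k) :=
    (tendsto_rpow_neg_nhdsGT_zero (neg_lt_zero.2 hk)).eventually_ge_atTop _
  have h2 : ∀ᶠ r : ℝ in 𝓝[>] 0, r < min d ρ :=
    nhdsWithin_le_nhds (gt_mem_nhds (lt_min hd hρ))
  obtain ⟨r, h1r, h2r, h3r⟩ := (h1.and (h2.and self_mem_nhdsWithin)).exists
  refine ⟨r, h3r, h2r.trans_le (min_le_right _ _), fun x hx => ?_⟩
  have h4 := hd' (y := x) (by rw [dist_zero_right, hx]; exact h2r.trans_le (min_le_left _ _))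
  rw [div_le_iff₀ hε] at h1r
  linarith

/-- Liouville-type comparison: solutions below the singular state are ordered once their difference
is `o(|x|^{-k})` from above at infinity, or merely `O(|x|^{-k})` when `k` is a double root. -/
lemma sub_nonpos_of_decay {N : ℕ} {p k : ℝ} (hp : 1 < p) (hm : decayExp p < (N : ℝ) - 2)
    (hk0 : 0 < k) (hk : k * ((N : ℝ) - 2 - k) = p * (decayExp p * ((N : ℝ) - 2 - decayExp p)))
    {u₁ u₂ : Space N → ℝ} (h₁ : IsSubsingularSolution p u₁) (h₂ : IsSubsingularSolution p u₂)
    (hdecay : (∀ ε > 0, ∀ᶠ x in Bornology.cobounded (Space N), u₁ x - u₂ x ≤ ε * ‖x‖ ^ (-k)) ∨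
      ((N : ℝ) - 2 - 2 * k = 0 ∧
        ∃ C : ℝ, ∀ᶠ x in Bornology.cobounded (Space N), u₁ x - u₂ x ≤ C * ‖x‖ ^ (-k)))
    {x : Space N} (hx : x ≠ 0) : u₁ x - u₂ x ≤ 0 := by
  have hx0 : 0 < ‖x‖ := norm_pos_iff.2 hx
  have hv := h₁.contDiff.continuous.sub h₂.contDiff.continuous
  suffices h : ∀ ε > 0, u₁ x - u₂ x ≤ ε * ‖x‖ ^ (-k) by
    refine ge_of_tendsto (x := 𝓝[>] (0 : ℝ)) (f := fun ε : ℝ => ε * ‖x‖ ^ (-k)) ?_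
      (eventually_mem_nhdsWithin.mono h)
    refine tendsto_nhdsWithin_of_tendsto_nhds ?_
    have hc : Continuous fun ε : ℝ => ε * ‖x‖ ^ (-k) := by fun_prop
    simpa using hc.tendsto 0
  intro ε hε
  obtain ⟨r, hr0, hrx, hr⟩ := exists_radius_le_rpow hk0 hε hx0 hv
  rcases hdecay with hdecay | ⟨hk2, C, hC⟩
  · have hb : ∀ s : ℝ, barrier k ε 0 s = ε * s ^ (-k) := fun s => by
      rw [barrier]
      ring
    rw [← hb]
    refine sub_le_barrier hp hm hk (zero_mul _) h₁ h₂ hr0 (fun s hs => ?_) (fun y hy => ?_) ?_ hrx.le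
    · rw [hb]
      exact mul_pos hε (Real.rpow_pos_of_pos (hr0.trans_le hs) _)
    · rw [hb, hy]
      exact hr y hy
    · simpa only [hb] using hdecay ε hε
  · -- The slowly growing factor `ε + δ log (s / r)` eventually dominates `C`; then let `δ → 0`.
    have hb : ∀ δ s : ℝ, barrier k (ε - δ * Real.log r) δ s =
        (ε + δ * (Real.log s - Real.log r)) * s ^ (-k) := fun δ s => by
      rw [barrier]
      ring
    have key : ∀ δ > 0, u₁ x - u₂ x ≤ (ε + δ * (Real.log ‖x‖ - Real.log r)) * ‖x‖ ^ (-k) := by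
      intro δ hδ
      rw [← hb]
      refine sub_le_barrier hp hm hk (by rw [hk2, mul_zero]) h₁ h₂ hr0 (fun s hs => ?_)
        (fun y hy => ?_) ?_ hrx.le
      · have h1 := Real.log_le_log hr0 hs
        have h2 : 0 ≤ δ * (Real.log s - Real.log r) := mul_nonneg hδ.le (by linarith)
        rw [hb]
        exact mul_pos (by linarith) (Real.rpow_pos_of_pos (hr0.trans_le hs) _)
      · rw [hb, hy, sub_self, mul_zero, add_zero]
        exact hr y hy
      · have hlog : Tendsto (fun y : Space N => Real.log ‖y‖) (Bornology.cobounded (Space N)) atTop :=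
          Real.tendsto_log_atTop.comp tendsto_norm_cobounded_atTop
        filter_upwards [hC, hlog.eventually_ge_atTop ((C - ε) / δ + Real.log r)] with y hy1 hy2
        rw [hb]
        refine hy1.trans (mul_le_mul_of_nonneg_right ?_ (Real.rpow_nonneg (norm_nonneg y) _))
        have h1 : (C - ε) / δ ≤ Real.log ‖y‖ - Real.log r := by linarith
        rw [div_le_iff₀ hδ] at h1
        linarith
    refine ge_of_tendsto (x := 𝓝[>] (0 : ℝ)) (f := fun δ : ℝ =>
      (ε + δ * (Real.log ‖x‖ - Real.log r)) * ‖x‖ ^ (-k)) ?_ (eventually_mem_nhdsWithin.mono key)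
    refine tendsto_nhdsWithin_of_tendsto_nhds ?_
    have hc : Continuous fun δ : ℝ => (ε + δ * (Real.log ‖x‖ - Real.log r)) * ‖x‖ ^ (-k) := by
      fun_prop
    simpa using hc.tendsto 0

/-! ### Symmetries of the Laplacian -/

lemma laplacian_comp_linearIsometryEquiv {N : ℕ} {u : Space N → ℝ} (hu : ContDiff ℝ 2 u)
    (R : Space N ≃ₗᵢ[ℝ] Space N) (x : Space N) : Δ (fun y => u (R y)) x = Δ u (R x) := by
  have h : ContDiff ℝ 2 fun y => u (R y) := hu.comp R.contDiff
  rw [laplacian_eq_sum_deriv h.contDiffAt,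
    InnerProductSpace.laplacian_eq_iteratedFDeriv_orthonormalBasis u
      ((EuclideanSpace.basisFun (Fin N) ℝ).map R)]
  refine Finset.sum_congr rfl fun i _ => ?_
  rw [OrthonormalBasis.map_apply, ← deriv_deriv_line hu.contDiffAt]
  simp only [map_add, map_smul]

lemma laplacian_mul_comp_smul {N : ℕ} {u : Space N → ℝ} (hu : ContDiff ℝ 2 u) (a c : ℝ)
    (x : Space N) : Δ (fun y => a * u (c • y)) x = a * c ^ 2 * Δ u (c • x) := by
  have h : ContDiff ℝ 2 fun y => a * u (c • y) :=
    contDiff_const.mul (hu.comp (contDiff_id.const_smul c))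
  rw [laplacian_eq_sum_deriv h.contDiffAt, laplacian_eq_sum_deriv hu.contDiffAt, Finset.mul_sum]
  refine Finset.sum_congr rfl fun i _ => ?_
  set v := EuclideanSpace.basisFun (Fin N) ℝ i
  set g : ℝ → ℝ := fun t => u (c • x + t • v) with hg
  have h1 : (fun t : ℝ => a * u (c • (x + t • v))) = fun t => a * g (c * t) := by
    funext t
    simp only [hg, smul_add, smul_smul]
  have h2 : deriv (fun t => a * g (c * t)) = fun t => a * c * deriv g (c * t) := by
    funext t
    rw [deriv_const_mul_field, deriv_comp_mul_left, smul_eq_mul, mul_assoc]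
  rw [h1, h2, deriv_const_mul_field, deriv_comp_mul_left (f := deriv g), smul_eq_mul, mul_zero]
  ring

lemma IsSubsingularSolution.comp_linearIsometryEquiv {N : ℕ} {p : ℝ} {u : Space N → ℝ}
    (h : IsSubsingularSolution p u) (R : Space N ≃ₗᵢ[ℝ] Space N) :
    IsSubsingularSolution p fun x => u (R x) where
  contDiff := h.contDiff.comp R.contDiff
  equation x := by
    rw [laplacian_comp_linearIsometryEquiv h.contDiff]
    exact h.equation (R x)
  bound x hx := by
    simpa [singularState] using h.bound (R x) (by simpa using hx)

lemma isSubsingularSolution_zero {N : ℕ} {p : ℝ} (hp : 1 < p) (hm : decayExp p < (N : ℝ) - 2) :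
    IsSubsingularSolution p fun _ : Space N => 0 where
  contDiff := contDiff_const
  equation x := by simp
  bound x _ := by
    rw [abs_zero, singularState]
    exact mul_nonneg (singConst_pos hp hm).le (Real.rpow_nonneg (norm_nonneg x) _)

/-! ### Radial functions and their profiles -/

/-- `f` is the profile of the radial function `u` of class `C²`; it is an even function on `ℝ`,
which is where `f' (0) = 0` comes from. -/
structure IsProfile {N : ℕ} (u : Space N → ℝ) (f : ℝ → ℝ) : Prop where
  contDiff : ContDiff ℝ 2 f
  eq_norm : ∀ x, u x = f ‖x‖
  deriv_zero : deriv f 0 = 0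
  laplacian : ∀ x, x ≠ 0 → Δ u x = deriv (deriv f) ‖x‖ + ((N : ℝ) - 1) / ‖x‖ * deriv f ‖x‖

lemma IsRadial.exists_profile {N : ℕ} (hN : 0 < N) {u : Space N → ℝ} (hu : ContDiff ℝ 2 u)
    (hr : IsRadial u) : ∃ f, IsProfile u f := by
  set e : Space N := EuclideanSpace.basisFun (Fin N) ℝ ⟨0, hN⟩
  have he : ‖e‖ = 1 := (EuclideanSpace.basisFun (Fin N) ℝ).norm_eq_one _
  set f : ℝ → ℝ := fun r => u (r • e) with hf
  have hfC : ContDiff ℝ 2 f := hu.comp (contDiff_id.smul contDiff_const)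
  have hfC1 : ContDiff ℝ 1 (deriv f) := hfC.deriv' (n := 1)
  have heq : ∀ x, u x = f ‖x‖ := fun x => hr _ _ (by simp [norm_smul, he])
  refine ⟨f, hfC, heq, ?_, fun x hx => ?_⟩
  · have heven : (fun r => f (-r)) = f := by
      funext r
      exact hr _ _ (by simp [norm_smul])
    have h := deriv_comp_neg f 0
    rw [heven, neg_zero] at h
    linarith
  · rw [show u = fun y => f ‖y‖ from funext heq]
    exact laplacian_radial hx hfC.contDiffAt
      (Eventually.of_forall fun s => (hfC.differentiable (by simp) s).hasDerivAt)
      (hfC1.differentiable (by simp) _).hasDerivAt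

/-- A radial superharmonic function has a nonincreasing profile. -/
lemma IsProfile.antitoneOn {N : ℕ} (hN : 1 < N) {u : Space N → ℝ} {f : ℝ → ℝ} (h : IsProfile u f)
    (hΔ : ∀ x, Δ u x ≤ 0) : AntitoneOn f (Ici 0) := by
  have hN0 : 0 < N := by omega
  have hd1 : Differentiable ℝ (deriv f) := (h.contDiff.deriv' (n := 1)).differentiable (by simp)
  have hode : ∀ r : ℝ, 0 < r → deriv (deriv f) r + ((N : ℝ) - 1) / r * deriv f r ≤ 0 := by
    intro r hr
    set x : Space N := r • EuclideanSpace.basisFun (Fin N) ℝ ⟨0, hN0⟩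
    have hx : ‖x‖ = r := by
      simp [x, norm_smul, abs_of_pos hr]
    have := h.laplacian x (norm_pos_iff.1 (hx ▸ hr))
    rw [hx] at this
    exact this ▸ hΔ x
  obtain ⟨n, rfl⟩ : ∃ n, N = n + 2 := ⟨N - 2, by omega⟩
  have hflux : AntitoneOn (fun r : ℝ => r ^ (n + 1) * deriv f r) (Ici 0) := by
    refine antitoneOn_of_deriv_nonpos (convex_Ici 0) ?_ ?_ fun r hr => ?_
    · exact ((continuous_pow _).mul hd1.continuous).continuousOn
    · exact ((differentiable_pow _).mul hd1).differentiableOn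
    · rw [interior_Ici] at hr
      have h1 := ((hasDerivAt_pow (n + 1) r).fun_mul (hd1 r).hasDerivAt).deriv
      rw [h1]
      have h2 := mul_nonpos_of_nonneg_of_nonpos (pow_pos hr (n + 1)).le (hode r hr)
      have hr0 : r ≠ 0 := ne_of_gt hr
      calc _ = r ^ (n + 1) * (deriv (deriv f) r + (((n + 2 : ℕ) : ℝ) - 1) / r * deriv f r) := by
            push_cast
            rw [pow_succ]
            field_simp
            ring
        _ ≤ 0 := h2
  refine antitoneOn_of_deriv_nonpos (convex_Ici 0) h.contDiff.continuous.continuousOn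
    (h.contDiff.differentiable (by simp)).differentiableOn fun r hr => ?_
  rw [interior_Ici] at hr
  have h3 := hflux self_mem_Ici (le_of_lt hr : (0 : ℝ) ≤ r) (le_of_lt hr)
  simp only [h.deriv_zero, mul_zero] at h3
  exact nonpos_of_mul_nonpos_right h3 (pow_pos hr (n + 1))

/-- Uniqueness for the singular initial value problem: the friction term `(N - 1) / r * f'` has the
good sign, so the energy `(f - g)'² + (f - g)²` satisfies a Gronwall inequality. -/
lemma IsProfile.eq_of_eq_zero {N : ℕ} (hN : 0 < N) {p : ℝ} (hp : 1 < p) {u v : Space N → ℝ}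
    {f g : ℝ → ℝ} (hf : IsProfile u f) (hg : IsProfile v g) (hu0 : ∀ x, 0 ≤ u x)
    (hv0 : ∀ x, 0 ≤ v x) (hu : ∀ x, Δ u x + u x ^ p = 0) (hv : ∀ x, Δ v x + v x ^ p = 0)
    (h0 : u 0 = v 0) : u = v := by
  have hNr : (1 : ℝ) ≤ N := by exact_mod_cast hN
  have profile : ∀ {w : Space N → ℝ} {h : ℝ → ℝ}, IsProfile w h → (∀ x, 0 ≤ w x) →
      (∀ x, Δ w x + w x ^ p = 0) → ∀ r : ℝ, 0 < r → 0 ≤ h r ∧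
        deriv (deriv h) r = -(((N : ℝ) - 1) / r * deriv h r) - h r ^ p := by
    intro w h hw hw0 hwe r hr
    set x : Space N := r • EuclideanSpace.basisFun (Fin N) ℝ ⟨0, hN⟩
    have hx : ‖x‖ = r := by
      simp [x, norm_smul, abs_of_pos hr]
    have h1 := hw.laplacian x (norm_pos_iff.1 (hx ▸ hr))
    have h2 := hwe x
    have h3 := hw.eq_norm x
    rw [hx] at h1 h3
    refine ⟨h3 ▸ hw0 x, ?_⟩
    rw [h1, h3] at h2
    linarith
  funext x
  rw [hf.eq_norm, hg.eq_norm]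
  set R := ‖x‖
  have hR : 0 ≤ R := norm_nonneg x
  have hf1 : Differentiable ℝ f := hf.contDiff.differentiable (by simp)
  have hg1 : Differentiable ℝ g := hg.contDiff.differentiable (by simp)
  have hf2 : Differentiable ℝ (deriv f) := (hf.contDiff.deriv' (n := 1)).differentiable (by simp)
  have hg2 : Differentiable ℝ (deriv g) := (hg.contDiff.deriv' (n := 1)).differentiable (by simp)
  obtain ⟨M, hM⟩ := (isCompact_Icc (a := (0 : ℝ)) (b := R)).exists_bound_of_continuousOn
    (f := fun r => |f r| + |g r|) (hf1.continuous.abs.add hg1.continuous.abs).continuousOn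
  set K := p * M ^ (p - 1)
  have hlip : ∀ r ∈ Ioo 0 R, |f r ^ p - g r ^ p| ≤ K * |f r - g r| := by
    intro r hr
    have h1 := hM r (Ioo_subset_Icc_self hr)
    have hfr := (profile hf hu0 hu r hr.1).1
    have hgr := (profile hg hv0 hv r hr.1).1
    rw [Real.norm_eq_abs, abs_of_nonneg (by positivity), abs_of_nonneg hfr, abs_of_nonneg hgr] at h1
    rcases lt_trichotomy (f r) (g r) with h | h | h
    · have h2 := abs_rpow_mul_self_sub_lt (M := M) hp (by linarith) h (by linarith)
      rw [abs_rpow_mul_self_of_nonneg hp hfr, abs_rpow_mul_self_of_nonneg hp hgr] at h2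
      have h3 := Real.rpow_le_rpow hfr h.le (by linarith : 0 ≤ p)
      rw [abs_sub_comm, abs_of_nonneg (by linarith), abs_sub_comm, abs_of_pos (by linarith)]
      exact h2.le
    · simp [h]
    · have h2 := abs_rpow_mul_self_sub_lt (M := M) hp (by linarith) h (by linarith)
      rw [abs_rpow_mul_self_of_nonneg hp hfr, abs_rpow_mul_self_of_nonneg hp hgr] at h2
      have h3 := Real.rpow_le_rpow hgr h.le (by linarith : 0 ≤ p)
      rw [abs_of_nonneg (by linarith), abs_of_pos (by linarith)]
      exact h2.le
  set E : ℝ → ℝ := fun r => (deriv f r - deriv g r) ^ 2 + (f r - g r) ^ 2 with hE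
  have hEd : ∀ r, HasDerivAt (fun r => E r * Real.exp (-(K + 1) * r))
      ((2 * (deriv f r - deriv g r) * (deriv (deriv f) r - deriv (deriv g) r) +
        2 * (f r - g r) * (deriv f r - deriv g r)) * Real.exp (-(K + 1) * r) +
        E r * (Real.exp (-(K + 1) * r) * -(K + 1))) r := by
    intro r
    have h1 := ((hf2 r).hasDerivAt.fun_sub (hg2 r).hasDerivAt).fun_pow 2
    have h2 := ((hf1 r).hasDerivAt.fun_sub (hg1 r).hasDerivAt).fun_pow 2
    have h3 : HasDerivAt (fun r : ℝ => Real.exp (-(K + 1) * r))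
        (Real.exp (-(K + 1) * r) * -(K + 1)) r := by
      simpa using ((hasDerivAt_id r).const_mul (-(K + 1))).exp
    refine ((h1.fun_add h2).fun_mul h3).congr_deriv ?_
    simp only [hE, Nat.cast_ofNat, Nat.add_one_sub_one, pow_one]
  have hanti : AntitoneOn (fun r => E r * Real.exp (-(K + 1) * r)) (Icc 0 R) := by
    refine antitoneOn_of_deriv_nonpos (convex_Icc 0 R)
      (fun r _ => (hEd r).continuousAt.continuousWithinAt)
      (fun r _ => (hEd r).differentiableAt.differentiableWithinAt) fun r hr => ?_
    rw [interior_Icc] at hr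
    rw [(hEd r).deriv, (profile hf hu0 hu r hr.1).2, (profile hg hv0 hv r hr.1).2]
    have hq : 0 ≤ ((N : ℝ) - 1) / r := div_nonneg (by linarith) hr.1.le
    have hl := hlip r hr
    set a := deriv f r - deriv g r with ha
    set b := f r - g r with hb
    set q := ((N : ℝ) - 1) / r
    set c := f r ^ p - g r ^ p with hc
    have h1 : a * -c ≤ |a| * (K * |b|) :=
      (le_abs_self _).trans (by rw [abs_mul, abs_neg]; gcongr)
    have h2 : a * b ≤ |a| * |b| := (le_abs_self _).trans (abs_mul a b).le
    have hK : 0 ≤ K := by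
      have : 0 ≤ M := (norm_nonneg _).trans (hM 0 ⟨le_rfl, hR⟩)
      positivity
    have h3 : 2 * (|a| * |b|) ≤ a ^ 2 + b ^ 2 := by
      have := two_mul_le_add_sq |a| |b|
      rw [sq_abs, sq_abs] at this
      linarith
    have h4 : 2 * a * (-(q * deriv f r) - f r ^ p - (-(q * deriv g r) - g r ^ p)) + 2 * b * a ≤
        (K + 1) * (a ^ 2 + b ^ 2) := by
      have e1 : -(q * deriv f r) - f r ^ p - (-(q * deriv g r) - g r ^ p) = -(q * a) - c := by
        rw [ha, hc]
        ring
      have h5 := mul_le_mul_of_nonneg_left h3 (by linarith : 0 ≤ K + 1)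
      have h6 := mul_nonneg hq (sq_nonneg a)
      rw [e1]
      linarith
    have h7 := mul_le_mul_of_nonneg_right h4 (Real.exp_pos (-(K + 1) * r)).le
    simp only [hE]
    linarith
  have hfin := hanti (left_mem_Icc.2 hR) (right_mem_Icc.2 hR) hR
  have hE0 : E 0 = 0 := by
    have : f 0 = g 0 := by simpa [hf.eq_norm, hg.eq_norm] using h0
    simp [hE, hf.deriv_zero, hg.deriv_zero, this]
  simp only [hE0, zero_mul] at hfin
  have h8 := nonpos_of_mul_nonpos_left hfin (Real.exp_pos _)
  simp only [hE] at h8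
  have h9 : (f R - g R) ^ 2 = 0 :=
    le_antisymm (by linarith [sq_nonneg (deriv f R - deriv g R)]) (sq_nonneg _)
  linarith [pow_eq_zero_iff (two_ne_zero) |>.1 h9]

lemma IsRadialSteadyState.unique {N : ℕ} (hN : 0 < N) {p : ℝ} (hp : 1 < p) {Φ Ψ : Space N → ℝ}
    (hΦ : IsRadialSteadyState p Φ) (hΨ : IsRadialSteadyState p Ψ) : Ψ = Φ := by
  obtain ⟨f, hf⟩ := hΦ.radial.exists_profile hN hΦ.contDiff
  obtain ⟨g, hg⟩ := hΨ.radial.exists_profile hN hΨ.contDiff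
  exact hg.eq_of_eq_zero hN hp hf (fun x => (hΨ.pos x).le) (fun x => (hΦ.pos x).le) hΨ.equation
    hΦ.equation (hΨ.value_zero.trans hΦ.value_zero.symm)

/-! ### From the asymptotics to the conclusion -/

/-- An expansion with leading term `L |x|^{-m}` and corrections of order `|x|^{-(m+λ)} log |x|`
forces positivity at infinity. -/
lemma eventually_pos_of_expansion {N : ℕ} {L m l D D' : ℝ} (hL : 0 < L) (hl : 0 < l)
    {u : Space N → ℝ} (h : ∀ᶠ x in Bornology.cobounded (Space N),
      L * ‖x‖ ^ (-m) - (D + D' * Real.log ‖x‖) * ‖x‖ ^ (-(m + l)) ≤ u x) :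
    ∀ᶠ x in Bornology.cobounded (Space N), 0 < u x := by
  have h1 : Tendsto (fun s : ℝ => s ^ (-l)) atTop (𝓝 0) := tendsto_rpow_neg_atTop hl
  have h2 : Tendsto (fun s : ℝ => Real.log s * s ^ (-l)) atTop (𝓝 0) := by
    refine (isLittleO_log_rpow_atTop hl).tendsto_div_nhds_zero.congr' ?_
    filter_upwards [eventually_ge_atTop 0] with s hs
    rw [Real.rpow_neg hs, div_eq_mul_inv]
  have h3 : Tendsto (fun s : ℝ => D * s ^ (-l) + D' * (Real.log s * s ^ (-l))) atTop (𝓝 0) := by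
    simpa using (h1.const_mul D).add (h2.const_mul D')
  have h4 := tendsto_norm_cobounded_atTop (E := Space N) |>.eventually
    ((h3.eventually (gt_mem_nhds hL)).and (eventually_gt_atTop 0))
  filter_upwards [h, h4] with x hx hx'
  refine lt_of_lt_of_le ?_ hx
  have h5 := mul_pos (Real.rpow_pos_of_pos hx'.2 (-m)) (sub_pos.2 hx'.1)
  rw [neg_add, Real.rpow_add hx'.2]
  linarith

/-- A solution below the singular state which at infinity is a radial function plus `o(|x|^{-k})`,
or plus `O(|x|^{-k})` when `k` is a double root, coincides with each of its reflections. -/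
lemma IsSubsingularSolution.isRadial {N : ℕ} {p k : ℝ} (hp : 1 < p)
    (hm : decayExp p < (N : ℝ) - 2) (hk0 : 0 < k)
    (hk : k * ((N : ℝ) - 2 - k) = p * (decayExp p * ((N : ℝ) - 2 - decayExp p)))
    {u : Space N → ℝ} (hu : IsSubsingularSolution p u) {G : ℝ → ℝ}
    (hdecay : (∀ ε > 0, ∀ᶠ x in Bornology.cobounded (Space N), |u x - G ‖x‖| ≤ ε * ‖x‖ ^ (-k)) ∨
      ((N : ℝ) - 2 - 2 * k = 0 ∧
        ∃ C : ℝ, ∀ᶠ x in Bornology.cobounded (Space N), |u x - G ‖x‖| ≤ C * ‖x‖ ^ (-k))) :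
    IsRadial u := by
  have key : ∀ (R : Space N ≃ₗᵢ[ℝ] Space N) (x : Space N), x ≠ 0 → u x - u (R x) ≤ 0 ∧
      u (R x) - u x ≤ 0 := by
    intro R x hx
    have hR : Tendsto R (Bornology.cobounded (Space N)) (Bornology.cobounded (Space N)) := by
      rw [← tendsto_norm_atTop_iff_cobounded]
      simpa using tendsto_norm_cobounded_atTop
    have hdouble : ∀ C : ℝ,
        (∀ᶠ x in Bornology.cobounded (Space N), |u x - G ‖x‖| ≤ C * ‖x‖ ^ (-k)) →
        ∀ᶠ x in Bornology.cobounded (Space N), |u x - u (R x)| ≤ 2 * C * ‖x‖ ^ (-k) := by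
      intro C hC
      filter_upwards [hC, hR.eventually hC] with y h1 h2
      rw [R.norm_map] at h2
      rw [abs_le] at h1 h2 ⊢
      constructor <;> linarith [h1.1, h1.2, h2.1, h2.2]
    have hd : (∀ ε > 0, ∀ᶠ x in Bornology.cobounded (Space N),
        |u x - u (R x)| ≤ ε * ‖x‖ ^ (-k)) ∨ ((N : ℝ) - 2 - 2 * k = 0 ∧
        ∃ C : ℝ, ∀ᶠ x in Bornology.cobounded (Space N), |u x - u (R x)| ≤ C * ‖x‖ ^ (-k)) := by
      refine hdecay.imp (fun h ε hε => ?_) fun ⟨h, C, hC⟩ => ⟨h, 2 * C, hdouble C hC⟩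
      simpa only [mul_div_cancel₀ ε (two_ne_zero' ℝ)] using hdouble (ε / 2) (h _ (half_pos hε))
    have hv := hu.comp_linearIsometryEquiv R
    constructor
    · refine sub_nonpos_of_decay hp hm hk0 hk hu hv ?_ hx
      exact hd.imp (fun h ε hε => (h ε hε).mono fun y hy => (le_abs_self _).trans hy)
        fun ⟨h, C, hC⟩ => ⟨h, C, hC.mono fun y hy => (le_abs_self _).trans hy⟩
    · refine sub_nonpos_of_decay hp hm hk0 hk hv hu ?_ hx
      simp only [abs_sub_comm (u _) (u (R _))] at hd
      exact hd.imp (fun h ε hε => (h ε hε).mono fun y hy => (le_abs_self _).trans hy)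
        fun ⟨h, C, hC⟩ => ⟨h, C, hC.mono fun y hy => (le_abs_self _).trans hy⟩
  intro x y hxy
  rcases eq_or_ne x 0 with rfl | hx
  · rw [norm_zero, eq_comm, norm_eq_zero] at hxy
    rw [hxy]
  · have h := key (Submodule.reflection (Submodule.span ℝ {x - y})ᗮ) x hx
    rw [Submodule.reflection_sub hxy] at h
    linarith [h.1, h.2]

/-- A solution below the singular state which is positive at infinity is nonnegative: compare the
zero solution with it. -/
lemma IsSubsingularSolution.nonneg {N : ℕ} {p k : ℝ} (hp : 1 < p)
    (hm : decayExp p < (N : ℝ) - 2) (hk0 : 0 < k)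
    (hk : k * ((N : ℝ) - 2 - k) = p * (decayExp p * ((N : ℝ) - 2 - decayExp p)))
    {u : Space N → ℝ} (hu : IsSubsingularSolution p u)
    (hpos : ∀ᶠ x in Bornology.cobounded (Space N), 0 < u x) {x : Space N} (hx : x ≠ 0) :
    0 ≤ u x := by
  have h := sub_nonpos_of_decay hp hm hk0 hk (isSubsingularSolution_zero hp hm) hu
    (Or.inl fun ε hε => hpos.mono fun y hy => ?_) hx
  · linarith
  · have : 0 ≤ ε * ‖y‖ ^ (-k) := mul_nonneg hε.le (Real.rpow_nonneg (norm_nonneg y) _)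
    linarith

/-- A radial nonnegative solution that is positive at infinity is positive everywhere, since its
profile is nonincreasing. -/
lemma IsRadial.pos_of_eventually_pos {N : ℕ} (hN : 1 < N) {u : Space N → ℝ}
    (hu : ContDiff ℝ 2 u) (hr : IsRadial u) (hΔ : ∀ x, Δ u x ≤ 0)
    (hpos : ∀ᶠ x in Bornology.cobounded (Space N), 0 < u x) (x : Space N) : 0 < u x := by
  have hN0 : 0 < N := by omega
  obtain ⟨f, hf⟩ := hr.exists_profile hN0 hu
  obtain ⟨R, -, hR⟩ := Filter.hasBasis_cobounded_norm.mem_iff.1 hpos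
  set z : Space N := max R ‖x‖ • EuclideanSpace.basisFun (Fin N) ℝ ⟨0, hN0⟩
  have h0 : 0 ≤ max R ‖x‖ := (norm_nonneg x).trans (le_max_right _ _)
  have hz : ‖z‖ = max R ‖x‖ := by
    simp [z, norm_smul, abs_of_nonneg h0]
  have hz' : 0 < u z := hR (show R ≤ ‖z‖ from hz ▸ le_max_left _ _)
  have h := hf.antitoneOn hN hΔ (norm_nonneg x) (norm_nonneg z) (hz ▸ le_max_right _ _)
  rw [← hf.eq_norm, ← hf.eq_norm] at h
  linarith

/-- A positive radial solution `u` is the rescaling by `γ = u 0` of a steady state normalized at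
the origin. -/
lemma exists_isRadialSteadyState_rescale {N : ℕ} {p : ℝ} {u : Space N → ℝ} (hu : ContDiff ℝ 2 u)
    (hr : IsRadial u) (hpos : ∀ x, 0 < u x) (heq : ∀ x, Δ u x + u x ^ p = 0) :
    ∃ Φ : Space N → ℝ, IsRadialSteadyState p Φ ∧ ∀ x, u x = rescale p Φ (u 0) x := by
  set γ := u 0
  have hγ : 0 < γ := hpos 0
  set c := γ ^ ((p - 1) / 2)
  have hc : 0 < c := Real.rpow_pos_of_pos hγ _
  have hc2 : c ^ 2 = γ ^ (p - 1) := by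
    rw [← Real.rpow_natCast, ← Real.rpow_mul hγ.le]
    norm_num
  refine ⟨fun x => γ⁻¹ * u (c⁻¹ • x), ⟨?_, fun x => mul_pos (inv_pos.2 hγ) (hpos _), fun x => ?_,
    fun x y hxy => ?_, ?_⟩, fun x => ?_⟩
  · exact contDiff_const.mul (hu.comp (contDiff_id.const_smul _))
  · rw [laplacian_mul_comp_smul hu, eq_neg_of_add_eq_zero_left (heq (c⁻¹ • x)),
      Real.mul_rpow (inv_pos.2 hγ).le (hpos _).le, Real.inv_rpow hγ.le, inv_pow, hc2,
      Real.rpow_sub_one hγ.ne']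
    have := (Real.rpow_pos_of_pos hγ p).ne'
    field_simp
    ring
  · rw [hr (c⁻¹ • x) (c⁻¹ • y) (by rw [norm_smul, norm_smul, hxy])]
  · simp only [smul_zero]
    exact inv_mul_cancel₀ hγ.ne'
  · have : c⁻¹ • γ ^ ((p - 1) / 2) • x = x := inv_smul_smul₀ hc.ne' x
    simp only [rescale, this]
    field_simp

theorem theorem1p6 (N : ℕ) (p : ℝ) (hp : jlExponent N ≤ (p : EReal))
    (u : Space N → ℝ) (hu : ContDiff ℝ 2 u)
    (heq : ∀ x, Δ u x + |u x| ^ (p - 1) * u x = 0)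
    (hbound : ∀ x, x ≠ 0 → |u x| ≤ singularState N p x)
    (hasym_super : jlExponent N < (p : EReal) → ∃ a : ℝ, a ≤ 0 ∧
      (fun x : Space N => u x - (singConst N p / ‖x‖ ^ decayExp p
          + a * (1 / ‖x‖ ^ (decayExp p + lambdaOne N p))))
        =o[Bornology.cobounded (Space N)]
          (fun x : Space N => 1 / ‖x‖ ^ (decayExp p + lambdaOne N p)))
    (hasym_crit : (p : EReal) = jlExponent N → ∃ b : ℝ, b < 0 ∧
      (fun x : Space N => u x - (singConst N p / ‖x‖ ^ decayExp p
          + b * (Real.log ‖x‖ / ‖x‖ ^ (decayExp p + lambdaOne N p))))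
        =O[Bornology.cobounded (Space N)]
          (fun x : Space N => 1 / ‖x‖ ^ (decayExp p + lambdaOne N p))) :
    IsRadial u ∧
      ∃ Φ : Space N → ℝ, IsRadialSteadyState p Φ ∧
        (∀ Ψ : Space N → ℝ, IsRadialSteadyState p Ψ → Ψ = Φ) ∧
        ∃ γ : ℝ, 0 < γ ∧ ∀ x, u x = rescale p Φ γ x := by
  obtain ⟨hN, hp1, hm0, hm, hl0, hk, hcrit⟩ := exponent_relations hp
  set m := decayExp p
  set l := lambdaOne N p
  set L := singConst N p
  have hL : 0 < L := singConst_pos hp1 hm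
  have hk0 : 0 < m + l := by linarith
  have hsol : IsSubsingularSolution p u := ⟨hu, heq, hbound⟩
  have hw : ∀ (q : ℝ) (x : Space N), 1 / ‖x‖ ^ q = ‖x‖ ^ (-q) := fun q x => by
    rw [Real.rpow_neg (norm_nonneg x), one_div]
  have hwn : ∀ x : Space N, ‖1 / ‖x‖ ^ (m + l)‖ = ‖x‖ ^ (-(m + l)) := fun x => by
    rw [hw, Real.norm_of_nonneg (Real.rpow_nonneg (norm_nonneg x) _)]
  obtain ⟨hrad, hpos⟩ : IsRadial u ∧ ∀ᶠ x in Bornology.cobounded (Space N), 0 < u x := by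
    rcases hp.lt_or_eq with hlt | heq'
    · obtain ⟨a, -, ha⟩ := hasym_super hlt
      have hdecay : ∀ ε > 0, ∀ᶠ x in Bornology.cobounded (Space N),
          |u x - (L / ‖x‖ ^ m + a * (1 / ‖x‖ ^ (m + l)))| ≤ ε * ‖x‖ ^ (-(m + l)) := by
        intro ε hε
        filter_upwards [ha.bound hε] with x hx
        rwa [hwn, Real.norm_eq_abs] at hx
      refine ⟨hsol.isRadial hp1 hm hk0 hk
        (G := fun s => L / s ^ m + a * (1 / s ^ (m + l))) (Or.inl hdecay), ?_⟩
      refine eventually_pos_of_expansion (m := m) (D := 1 - a) (D' := 0) hL hl0 ?_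
      filter_upwards [hdecay 1 one_pos] with x hx
      have h1 := neg_le_of_abs_le hx
      rw [hw, div_eq_mul_one_div, hw] at h1
      linarith
    · obtain ⟨b, -, hb⟩ := hasym_crit heq'.symm
      obtain ⟨C, hC⟩ := hb.bound
      have hdecay : ∀ᶠ x in Bornology.cobounded (Space N),
          |u x - (L / ‖x‖ ^ m + b * (Real.log ‖x‖ / ‖x‖ ^ (m + l)))| ≤ C * ‖x‖ ^ (-(m + l)) := by
        filter_upwards [hC] with x hx
        rwa [hwn, Real.norm_eq_abs] at hx
      refine ⟨hsol.isRadial hp1 hm hk0 hk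
        (G := fun s => L / s ^ m + b * (Real.log s / s ^ (m + l)))
        (Or.inr ⟨hcrit heq'.symm, C, hdecay⟩), ?_⟩
      refine eventually_pos_of_expansion (m := m) (D := C) (D' := -b) hL hl0 ?_
      filter_upwards [hdecay] with x hx
      have h1 := neg_le_of_abs_le hx
      rw [div_eq_mul_one_div L, div_eq_mul_one_div (Real.log _), hw, hw] at h1
      linarith
  have hnonneg : ∀ x, 0 ≤ u x := by
    -- The comparison excludes the origin, which continuity fills in.
    have : Nonempty (Fin N) := ⟨⟨0, by omega⟩⟩
    have hclosed : IsClosed {x | 0 ≤ u x} := isClosed_le continuous_const hu.continuous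
    intro x
    exact hclosed.closure_subset_iff.2 (fun y hy => hsol.nonneg hp1 hm hk0 hk hpos hy)
      (dense_compl_singleton (0 : Space N) x)
  have heq' : ∀ x, Δ u x + u x ^ p = 0 := fun x => by
    rw [← abs_rpow_mul_self_of_nonneg hp1 (hnonneg x)]
    exact heq x
  have hΔ : ∀ x, Δ u x ≤ 0 := fun x => by
    linarith [heq' x, Real.rpow_nonneg (hnonneg x) p]
  have hupos := hrad.pos_of_eventually_pos (by omega) hu hΔ hpos
  obtain ⟨Φ, hΦ, hΦu⟩ := exists_isRadialSteadyState_rescale hu hrad hupos heq'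
  exact ⟨hrad, Φ, hΦ, fun Ψ hΨ => hΦ.unique (by omega) hp1 hΨ, u 0, hupos 0, hΦu⟩
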